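/- For integers $r\ge 2$, $k\ge 1$ put $u_{r,k}=k^{r-1}\ln k$. For $k\ge 2$ let $\mathcal K$ be the set of real $k\times k$ matrices $X=(x_{ij})$ with $0\le x_{ij}\le 1/k$ for all $i,j$, let $\mathcal W$ be the set of real $k\times k$ matrices all of whose row sums and column sums equal $1/k$, and let $J_0$ be the $k\times k$ matrix with all entries equal to $1/k^2$. For real $c$ and $X\in\mathcal K\cap \mathcal W$ put $$F(X)=-\sum_{i,j=1}^k x_{ij}\ln x_{ij}+c\,\ln\Big(1-\frac{2}{k^{r-1}}+\sum_{i,j=1}^k x_{ij}^r\Big),$$ with the convention $0\ln 0=0$. Lemma 2.2. Fix integers $r,k\ge 2$. There exists a positive constant $c_{r,k}\in(u_{r,k-1},u_{r,k})$, depending only on $r$ and $k$, which satisfies $$c_{r,k}\le\frac{(k^{r-1}-1)^2}{r(r-1)},$$ such that for every real $c<c_{r,k}$ the function $F$ on $\mathcal K\cap\mathcal W$ has a unique maximum, attained at the point $J_0$, which lies in $\mathcal K^\circ\cap\mathcal W$, where $\mathcal K^\circ$ is the interior of $\mathcal K$; that is, $F(X)<F(J_0)$ for all $X\in\mathcal K\cap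 \mathcal W$ with $X\ne J_0$. -/

import Mathlib

namespace HypergraphMoment

/-- The number `u_{r,k} = k^{r-1} ln k`. -/
noncomputable def u (r k : ℕ) : ℝ := (k : ℝ) ^ (r - 1) * Real.log k

/-- `F(X) = -∑ x_ij ln x_ij + c ln (1 - 2/k^{r-1} + ∑ x_ij^r)` on real `k × k` matrices.
As `Real.log 0 = 0`, the convention `0 ln 0 = 0` is in force. -/
noncomputable def F (r k : ℕ) (c : ℝ) (X : Matrix (Fin k) (Fin k) ℝ) : ℝ :=
  -(∑ i, ∑ j, X i j * Real.log (X i j)) +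
    c * Real.log (1 - 2 / (k : ℝ) ^ (r - 1) + ∑ i, ∑ j, X i j ^ r)

/-- The cube of matrices with all entries in `[0, 1/k]`. -/
def K (k : ℕ) : Set (Matrix (Fin k) (Fin k) ℝ) :=
  {X | ∀ i j, 0 ≤ X i j ∧ X i j ≤ 1 / (k : ℝ)}

/-- The affine subspace of matrices with all row sums and all column sums equal to `1/k`. -/
def W (k : ℕ) : Set (Matrix (Fin k) (Fin k) ℝ) :=
  {X | (∀ i, ∑ j, X i j = 1 / (k : ℝ)) ∧ (∀ j, ∑ i, X i j = 1 / (k : ℝ))}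

/-- The matrix with all entries equal to `1/k^2`. -/
noncomputable def J₀ (k : ℕ) : Matrix (Fin k) (Fin k) ℝ :=
  Matrix.of fun _ _ => 1 / (k : ℝ) ^ 2

end HypergraphMoment

/-!
Write `P = kX`, whose rows are probability vectors `p` on `k` points, and `q = k^{-(r-1)}`. At `J₀`
the argument of the logarithm in `F` is `(1 - q)^2`, and `log` is concave, so for `c > 0` it
suffices to compare two quantities additive over the rows of `P`: the entropy deficit
`log k - H(p)`, and `c q / (1 - q)^2` times `∑ p_j ^ r - q`. For `c ≤ 0` the logarithmic term is
itself largest at `J₀`. Both quantities are compared with the quadratic deviation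
`∑ p_j ^ 2 - 1 / k`.

The sharp entropy bound is `log k - H(p) ≥ a_k (∑ p_j ^ 2 - 1 / k)` with
`a_k = (k - 1) log (k - 1) / (k - 2)` and `a_2 = 1` (`sum_mul_log_ge`). The case of one distinguished
point and equal weights elsewhere is a sharp form of Pinsker's inequality for binary relative entropy
(`binEntropy_le_of_lt_half`); the general case is an induction on `k` that removes a largest entry,
and it closes because `a_k / k` decreases, which amounts to `sinh y / y` being increasing
(`entropyConst_succ_mul_le`).

For the power sums, the Taylor remainder of `x ^ r` at `1 / k` is at most `θ (x - 1 / k) ^ 2` on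
`[0, 1]` (`pow_le_tangent_add`), with `θ = 1` for `r = 2` and `θ = (1 - 1 / k)^{-2}` for `r ≥ 3`.
Hence `J₀` is the unique maximum for all `c < a_k (1 - q)^2 / (q θ)` (`F_lt_F_J₀`), and this
threshold exceeds `u r (k - 1)` (`exists_quadratic_majorant`). So do `u r k` and
`(k^{r-1} - 1)^2 / (r (r - 1))` (`u_pred_lt_u`, `u_pred_lt_bound`), and the constant can be
chosen strictly between `u r (k - 1)` and the least of the three.
-/

namespace HypergraphMoment

open Real Set

/-! ### Binary entropy -/

lemma convexOn_log_one_sub_sub_log :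
    ConvexOn ℝ (Ioc (0 : ℝ) (1 / 2)) fun x => log (1 - x) - log x := by
  have hd : ∀ x ∈ Ioo (0 : ℝ) (1 / 2),
      HasDerivAt (fun x => log (1 - x) - log x) (-(x * (1 - x))⁻¹) x := by
    intro x hx
    have h0 : x ≠ 0 := hx.1.ne'
    have h1 : 1 - x ≠ 0 := by linarith [hx.2]
    have := (((hasDerivAt_id x).const_sub 1).log h1).sub (hasDerivAt_log h0)
    refine this.congr_deriv ?_
    simp only [id]
    field_simp
    ring
  refine MonotoneOn.convexOn_of_deriv (convex_Ioc _ _) ?_ ?_ ?_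
  · refine ContinuousOn.sub (ContinuousOn.log (by fun_prop) ?_) (ContinuousOn.log (by fun_prop) ?_)
    · intro x hx; linarith [hx.2]
    · intro x hx; exact hx.1.ne'
  · rw [interior_Ioc]
    exact fun x hx => (hd x hx).differentiableAt.differentiableWithinAt
  · rw [interior_Ioc]
    intro x hx y hy hxy
    rw [(hd x hx).deriv, (hd y hy).deriv, neg_le_neg_iff]
    have hx' : 0 < x * (1 - x) := mul_pos hx.1 (by linarith [hx.2])
    exact inv_anti₀ hx' (by nlinarith [hx.1, hx.2, hy.1, hy.2])

/-- The left side minus the right side is increasing on `[0, q]` by `hsec`, decreasing on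
`[q, 1/2]` by convexity of the log-odds, symmetric about `1/2` by the choice of `φ`, and zero at
`q`. -/
lemma binEntropy_le_of_secant {q φ : ℝ} (hq0 : 0 < q) (hq : q ≤ 1 / 2)
    (hφ : φ * (1 - 2 * q) = log (1 - q) - log q)
    (hsec : ∀ x, 0 < x → x < q →
      2 * φ * (q - x) ≤ (log (1 - x) - log x) - (log (1 - q) - log q))
    {x : ℝ} (hx0 : 0 ≤ x) (hx1 : x ≤ 1) :
    binEntropy x ≤ -(x * log q) - (1 - x) * log (1 - q) - φ * (x - q) ^ 2 := by
  set G : ℝ → ℝ := fun x => binEntropy x + x * log q + (1 - x) * log (1 - q) + φ * (x - q) ^ 2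
    with hG
  have hcont : Continuous G := by
    have := binEntropy_continuous
    simp only [hG]
    fun_prop
  have hd : ∀ x, 0 < x → x < 1 → HasDerivAt G
      ((log (1 - x) - log x) - (log (1 - q) - log q) + 2 * φ * (x - q)) x := by
    intro x h0 h1
    have e1 := hasDerivAt_binEntropy h0.ne' h1.ne
    have e2 := (hasDerivAt_id x).mul_const (log q)
    have e3 := ((hasDerivAt_id x).const_sub 1).mul_const (log (1 - q))
    have e4 := (((hasDerivAt_id x).sub_const q).pow 2).const_mul φ
    refine (((e1.add e2).add e3).add e4).congr_deriv ?_
    simp only [id]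
    push_cast
    ring
  have hGq : G q = 0 := by
    simp only [hG, binEntropy_eq_negMulLog_add_negMulLog_one_sub, negMulLog]
    ring
  have hleft : MonotoneOn G (Icc 0 q) := by
    refine monotoneOn_of_deriv_nonneg (convex_Icc _ _) hcont.continuousOn ?_ ?_
    · rw [interior_Icc]
      exact fun y hy => (hd y hy.1 (by linarith [hy.2])).differentiableAt.differentiableWithinAt
    · rw [interior_Icc]
      intro y hy
      rw [(hd y hy.1 (by linarith [hy.2])).deriv]
      linarith [hsec y hy.1 hy.2]
  have hright : AntitoneOn G (Icc q (1 / 2)) := by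
    refine antitoneOn_of_deriv_nonpos (convex_Icc _ _) hcont.continuousOn ?_ ?_
    · rw [interior_Icc]
      exact fun y hy => (hd y (hq0.trans hy.1)
        (by linarith [hy.2])).differentiableAt.differentiableWithinAt
    · rw [interior_Icc]
      intro y hy
      rw [(hd y (hq0.trans hy.1) (by linarith [hy.2])).deriv]
      have hlt : q < 1 / 2 := hy.1.trans hy.2
      -- `y` lies on the chord between `q` and `1/2`, where the log-odds vanishes
      have hc := convexOn_log_one_sub_sub_log.2 (show q ∈ Ioc (0 : ℝ) (1 / 2) from ⟨hq0, hq⟩)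
        (show (1 / 2 : ℝ) ∈ Ioc (0 : ℝ) (1 / 2) from ⟨by norm_num, le_rfl⟩)
        (show 0 ≤ (1 / 2 - y) / (1 / 2 - q) from div_nonneg (by linarith [hy.2]) (by linarith))
        (show 0 ≤ (y - q) / (1 / 2 - q) from div_nonneg (by linarith [hy.1]) (by linarith))
        (by rw [← add_div, div_eq_one_iff_eq (by linarith)]; ring)
      have hy' : (1 / 2 - y) / (1 / 2 - q) * q + (y - q) / (1 / 2 - q) * (1 / 2) = y := by
        have : 1 - 2 * q ≠ 0 := by linarith
        field_simp
        ring
      simp only [smul_eq_mul, hy'] at hc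
      have h12 : log (1 - 1 / 2) - log (1 / 2 : ℝ) = 0 := by norm_num
      rw [h12, mul_zero, add_zero, ← hφ] at hc
      have h2 : (1 / 2 - y) / (1 / 2 - q) * (φ * (1 - 2 * q)) = φ * (1 - 2 * y) := by
        have : 1 - 2 * q ≠ 0 := by linarith
        field_simp
      rw [h2] at hc
      rw [← hφ]
      linarith
  have hhalf : ∀ x, 0 ≤ x → x ≤ 1 / 2 → G x ≤ 0 := by
    intro x h0 h1
    rw [← hGq]
    rcases le_total x q with h | h
    · exact hleft ⟨h0, h⟩ ⟨hq0.le, le_rfl⟩ h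
    · exact hright ⟨le_rfl, hq⟩ ⟨h, h1⟩ h
  have hsymm : G (1 - x) = G x := by
    simp only [hG, binEntropy_one_sub]
    linear_combination (1 - 2 * x) * hφ
  have hGx : G x ≤ 0 := by
    rcases le_total x (1 / 2) with h | h
    · exact hhalf x hx0 h
    · rw [← hsymm]
      exact hhalf _ (by linarith) (by linarith)
  simp only [hG] at hGx
  linarith

/-- Binary relative entropy against its second-order deviation, with the sharp constant
(the Kearns–Saul, or Ordentlich–Weinberger, refinement of Pinsker's inequality). -/
lemma binEntropy_le_of_lt_half {q : ℝ} (hq0 : 0 < q) (hq : q < 1 / 2)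
    {x : ℝ} (hx0 : 0 ≤ x) (hx1 : x ≤ 1) :
    binEntropy x ≤ -(x * log q) - (1 - x) * log (1 - q)
      - (log (1 - q) - log q) / (1 - 2 * q) * (x - q) ^ 2 := by
  have hne : 1 - 2 * q ≠ 0 := by linarith
  refine binEntropy_le_of_secant hq0 hq.le (div_mul_cancel₀ _ hne) ?_ hx0 hx1
  intro y hy0 hyq
  have h12 : log (1 - 1 / 2) - log (1 / 2 : ℝ) = 0 := by norm_num
  have e : (0 - (log (1 - q) - log q)) / (1 / 2 - q)
      = -(2 * ((log (1 - q) - log q) / (1 - 2 * q))) := by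
    have : 1 / 2 - q ≠ 0 := by linarith
    field_simp
    ring
  have h' : (log (1 - q) - log q) - (log (1 - y) - log y) ≤
      (0 - (log (1 - q) - log q)) / (1 / 2 - q) * (q - y) := by
    have := convexOn_log_one_sub_sub_log.slope_mono_adjacent (x := y) (y := q) (z := 1 / 2)
      ⟨hy0, by linarith⟩ ⟨by norm_num, le_rfl⟩ hyq hq
    simp only [h12] at this
    exact (div_le_iff₀ (by linarith)).1 this
  rw [e] at h'
  linarith

/-- Pinsker's inequality for the fair coin. -/
lemma binEntropy_le_log_two_sub {x : ℝ} (hx0 : 0 ≤ x) (hx1 : x ≤ 1) :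
    binEntropy x ≤ log 2 - 2 * (x - 1 / 2) ^ 2 := by
  have h := binEntropy_le_of_secant (q := 1 / 2) (φ := 2) (by norm_num) le_rfl (by norm_num)
    (fun y hy0 hy => by
      have hpos : 0 ≤ (1 - 2 * y) / y := div_nonneg (by linarith) hy0.le
      have h := le_log_one_add_of_nonneg hpos
      have e1 : 1 + (1 - 2 * y) / y = (1 - y) / y := by field_simp; ring
      have e2 : 2 * ((1 - 2 * y) / y) / ((1 - 2 * y) / y + 2) = 2 * (1 - 2 * y) := by
        have : (1 - 2 * y) / y + 2 = 1 / y := by field_simp; ring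
        rw [this]
        field_simp
      rw [e1, e2, log_div (by linarith) hy0.ne'] at h
      norm_num
      linarith) hx0 hx1
  have e : log (1 - 1 / 2 : ℝ) = -log 2 := by
    rw [show (1 - 1 / 2 : ℝ) = 2⁻¹ by norm_num, log_inv]
  have e' : log (1 / 2 : ℝ) = -log 2 := by rw [one_div, log_inv]
  rw [e, e'] at h
  linarith

/-! ### Entropy deficit and quadratic deviation -/

/-- The sharp constant `a` in `log n - H(p) ≥ a (∑ p_i² - 1/n)` for probability vectors `p` on
`n ≥ 2` points. The general formula is `0 / 0` at `n = 2`, where its limit `1` is taken; any value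
would do at `n = 1`, and `1/2` keeps `a / n` decreasing. -/
noncomputable def entropyConst (n : ℕ) : ℝ :=
  if n ≤ 2 then (n : ℝ) / 2 else ((n : ℝ) - 1) / ((n : ℝ) - 2) * log ((n : ℝ) - 1)

lemma entropyConst_pos {n : ℕ} (hn : 1 ≤ n) : 0 < entropyConst n := by
  unfold entropyConst
  have h1 : (1 : ℝ) ≤ n := by exact_mod_cast hn
  split_ifs with h
  · positivity
  · have h3 : (3 : ℝ) ≤ n := by exact_mod_cast (by omega : 3 ≤ n)
    exact mul_pos (div_pos (by linarith) (by linarith)) (log_pos (by linarith))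

/-- Equivalent to the monotonicity of `sinh y / y`, with `s = exp y`. -/
lemma log_mul_sub_inv_le {s t : ℝ} (hs : 1 ≤ s) (hst : s ≤ t) :
    log t * (s - s⁻¹) ≤ log s * (t - t⁻¹) := by
  set D : ℝ → ℝ := fun t => log s * (t - t⁻¹) - log t * (s - s⁻¹) with hD
  have hs0 : 0 < s := by linarith
  have hd : ∀ t, 0 < t → HasDerivAt D (log s * (1 + (t ^ 2)⁻¹) - t⁻¹ * (s - s⁻¹)) t := by
    intro t ht
    have e1 := ((hasDerivAt_id t).sub (hasDerivAt_inv ht.ne')).const_mul (log s)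
    have e2 := (hasDerivAt_log ht.ne').mul_const (s - s⁻¹)
    refine (e1.sub e2).congr_deriv ?_
    ring
  have hmono : MonotoneOn D (Ici s) := by
    refine monotoneOn_of_deriv_nonneg (convex_Ici _) ?_ ?_ ?_
    · exact fun y hy => (hd y (hs0.trans_le hy)).continuousAt.continuousWithinAt
    · rw [interior_Ici]
      exact fun y hy => (hd y (hs0.trans hy)).differentiableAt.differentiableWithinAt
    · rw [interior_Ici]
      intro y hy
      have hsy : s < y := hy
      have hy0 : 0 < y := hs0.trans hsy
      rw [(hd y hy0).deriv]
      have h1 := le_log_one_add_of_nonneg (x := s ^ 2 - 1) (by nlinarith)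
      rw [show 1 + (s ^ 2 - 1) = s ^ 2 by ring, log_pow, div_le_iff₀ (by nlinarith)] at h1
      push_cast at h1
      have h2 : s - s⁻¹ ≤ log s * (s + s⁻¹) := by
        have e : log s * (s + s⁻¹) - (s - s⁻¹) = (log s * (s ^ 2 + 1) - (s ^ 2 - 1)) / s := by
          field_simp
        have : 0 ≤ (log s * (s ^ 2 + 1) - (s ^ 2 - 1)) / s := div_nonneg (by nlinarith) hs0.le
        linarith
      have h3 : s + s⁻¹ ≤ y + y⁻¹ := by
        have e : y + y⁻¹ - (s + s⁻¹) = (y - s) * (s * y - 1) / (s * y) := by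
          field_simp
          ring
        have : 0 ≤ (y - s) * (s * y - 1) / (s * y) :=
          div_nonneg (mul_nonneg (by linarith) (by nlinarith)) (by positivity)
        linarith
      have h4 := mul_le_mul_of_nonneg_left h3 (log_nonneg hs)
      have e : log s * (1 + (y ^ 2)⁻¹) - y⁻¹ * (s - s⁻¹)
          = y⁻¹ * (log s * (y + y⁻¹) - (s - s⁻¹)) := by
        field_simp
      rw [e]
      exact mul_nonneg (by positivity) (by linarith)
  have h := hmono (mem_Ici.2 le_rfl) (mem_Ici.2 hst) hst
  simp only [hD] at h
  linarith

lemma entropyConst_succ_mul_le {n : ℕ} (hn : 1 ≤ n) :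
    entropyConst (n + 1) * n ≤ entropyConst n * (n + 1) := by
  obtain rfl | rfl | h3 : n = 1 ∨ n = 2 ∨ 3 ≤ n := by omega
  · norm_num [entropyConst]
  · have := log_two_lt_d9
    norm_num [entropyConst]
    linarith
  · have h3' : (3 : ℝ) ≤ n := by exact_mod_cast h3
    have h := log_mul_sub_inv_le (s := (n : ℝ) - 1) (t := n) (by linarith) (by linarith)
    rw [entropyConst, entropyConst, if_neg (by omega), if_neg (by omega)]
    push_cast
    have p1 : 0 < (n : ℝ) - 1 := by linarith
    have p2 : 0 < (n : ℝ) - 2 := by linarith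
    have e1 : (n : ℝ) - 1 - ((n : ℝ) - 1)⁻¹ = n * (n - 2) / (n - 1) := by
      field_simp
      ring
    have e2 : (n : ℝ) - (n : ℝ)⁻¹ = (n - 1) * (n + 1) / n := by
      field_simp
      ring
    rw [e1, e2] at h
    have c1 : (n + 1 - 1 : ℝ) = n := by ring
    have c2 : (n + 1 - 2 : ℝ) = n - 1 := by ring
    rw [c1, c2]
    calc (n : ℝ) / (n - 1) * log n * n = log n * (n * (n - 2) / (n - 1)) * (n / (n - 2)) := by
          field_simp
      _ ≤ log (n - 1) * ((n - 1) * (n + 1) / n) * (n / (n - 2)) :=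
          mul_le_mul_of_nonneg_right h (by positivity)
      _ = (n - 1) / (n - 2) * log (n - 1) * (n + 1) := by
          field_simp

lemma binEntropy_le_of_nat {n : ℕ} (hn : 1 ≤ n) {x : ℝ} (hx0 : 0 ≤ x) (hx1 : x ≤ 1) :
    binEntropy x ≤ log (n + 1) - (1 - x) * log n
      - entropyConst (n + 1) * (x ^ 2 + (1 - x) ^ 2 / n - 1 / (n + 1)) := by
  obtain rfl | h2 : n = 1 ∨ 2 ≤ n := by omega
  · have := binEntropy_le_log_two_sub hx0 hx1
    norm_num [entropyConst]
    linarith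
  · have h2' : (2 : ℝ) ≤ n := by exact_mod_cast h2
    have hq : 1 / ((n : ℝ) + 1) < 1 / 2 := by
      rw [div_lt_div_iff₀ (by linarith) (by norm_num)]
      linarith
    have h := binEntropy_le_of_lt_half (q := 1 / ((n : ℝ) + 1)) (by positivity) hq hx0 hx1
    have hn1 : (n : ℝ) - 1 ≠ 0 := by linarith
    have e1 : log (1 / ((n : ℝ) + 1)) = -log (n + 1) := by rw [one_div, log_inv]
    have e2 : log (1 - 1 / ((n : ℝ) + 1)) = log n - log (n + 1) := by
      rw [← log_div (by positivity) (by positivity)]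
      congr 1
      field_simp
      ring
    rw [e1, e2] at h
    rw [entropyConst, if_neg (by omega)]
    push_cast
    have e3 : (log n - log (n + 1) - -log (n + 1)) / (1 - 2 * (1 / ((n : ℝ) + 1)))
        * (x - 1 / (n + 1)) ^ 2
        = ((n : ℝ) + 1 - 1) / (n + 1 - 2) * log (n + 1 - 1)
          * (x ^ 2 + (1 - x) ^ 2 / n - 1 / (n + 1)) := by
      have c : 1 - 2 * (1 / ((n : ℝ) + 1)) = (n - 1) / (n + 1) := by field_simp; ring
      rw [c, show ((n : ℝ) + 1 - 1) = n by ring, show ((n : ℝ) + 1 - 2) = n - 1 by ring]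
      field_simp
      ring
    rw [e3] at h
    linarith

/-- The two-block inequality in homogeneous form: mass `x` at one point and `t` spread evenly over
`n` others. -/
lemma two_block_le {n : ℕ} (hn : 1 ≤ n) {x t : ℝ} (hx : 0 ≤ x) (ht : 0 ≤ t) (hs : 0 < x + t) :
    (x + t) * log ((x + t) / (n + 1))
      + entropyConst (n + 1) * ((x ^ 2 + t ^ 2 / n) / (x + t) - (x + t) / (n + 1))
      ≤ x * log x + t * log (t / n) := by
  have hn0 : (0 : ℝ) < n := by exact_mod_cast hn
  obtain ⟨s, hs'⟩ : ∃ s, s = x + t := ⟨_, rfl⟩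
  rw [← hs'] at hs ⊢
  obtain ⟨y, hy⟩ : ∃ y, y = x / s := ⟨_, rfl⟩
  have hxy : x = s * y := by rw [hy]; field_simp
  have hty : t = s * (1 - y) := by linarith
  have h := binEntropy_le_of_nat hn (x := y) (by rw [hy]; positivity)
    (by rw [hy, div_le_one hs]; linarith)
  rw [binEntropy_eq_negMulLog_add_negMulLog_one_sub] at h
  have l1 : x * log x = -(y * negMulLog s + s * negMulLog y) := by
    rw [← negMulLog_mul, ← hxy, negMulLog]; ring
  have l2 : t * log t = -((1 - y) * negMulLog s + s * negMulLog (1 - y)) := by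
    rw [← negMulLog_mul, ← hty, negMulLog]; ring
  have l3 : t * log (t / n) = t * log t - t * log n := by
    rcases ht.eq_or_lt with h0 | h0
    · rw [← h0]; simp
    · rw [log_div h0.ne' hn0.ne']; ring
  have l4 : s * log (s / (n + 1)) = -negMulLog s - s * log (n + 1) := by
    rw [log_div hs.ne' (by positivity), negMulLog]; ring
  have l5 : (x ^ 2 + t ^ 2 / n) / s - s / (n + 1)
      = s * (y ^ 2 + (1 - y) ^ 2 / n - 1 / (n + 1)) := by
    rw [hxy, hty]; field_simp
  rw [l3, l1, l2, l4, l5]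
  have := mul_le_mul_of_nonneg_left h hs.le
  rw [hty]
  linarith

/-- Entropy deficit against quadratic deviation from uniformity, with total mass unnormalised. By
induction on the number of points: removing a largest entry splits both sides by the chain rule
into a two-block part and a part on the remaining points, whose mass is at most `n / (n + 1)` of the
total, so that the decrease of `entropyConst n / n` suffices. -/
lemma sum_mul_log_ge {ι : Type*} [DecidableEq ι] {n : ℕ} (hn : 1 ≤ n) :
    ∀ (S : Finset ι) (f : ι → ℝ), S.card = n → (∀ i ∈ S, 0 ≤ f i) →
      (∑ i ∈ S, f i) * log ((∑ i ∈ S, f i) / n)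
        + entropyConst n * ((∑ i ∈ S, f i ^ 2) / (∑ i ∈ S, f i) - (∑ i ∈ S, f i) / n)
        ≤ ∑ i ∈ S, f i * log (f i) := by
  induction n, hn using Nat.le_induction with
  | base =>
    intro S f hS hf
    obtain ⟨j, rfl⟩ := Finset.card_eq_one.1 hS
    simp only [Finset.sum_singleton, Nat.cast_one, div_one]
    have : f j ^ 2 / f j = f j := by
      rcases eq_or_ne (f j) 0 with h | h
      · simp [h]
      · field_simp
    rw [this]
    simp
  | succ n hn ih =>
    intro S f hS hf
    have hn0 : (0 : ℝ) < n := by exact_mod_cast hn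
    have hne : S.Nonempty := by rw [← Finset.card_pos]; omega
    obtain ⟨j, hj, hmax⟩ := S.exists_max_image f hne
    have hcard : (S.erase j).card = n := by rw [Finset.card_erase_of_mem hj, hS]; rfl
    have hfT : ∀ i ∈ S.erase j, 0 ≤ f i := fun i hi => hf i (Finset.mem_of_mem_erase hi)
    have IH := ih (S.erase j) f hcard hfT
    rw [← Finset.add_sum_erase S f hj, ← Finset.add_sum_erase S (fun i => f i ^ 2) hj,
      ← Finset.add_sum_erase S (fun i => f i * log (f i)) hj]
    have ht0 : 0 ≤ ∑ i ∈ S.erase j, f i := Finset.sum_nonneg hfT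
    have htx : ∑ i ∈ S.erase j, f i ≤ n * f j := by
      have := Finset.sum_le_card_nsmul (S.erase j) f (f j)
        fun i hi => hmax i (Finset.mem_of_mem_erase hi)
      rwa [hcard, nsmul_eq_mul] at this
    have hCS : (∑ i ∈ S.erase j, f i) ^ 2 ≤ n * ∑ i ∈ S.erase j, f i ^ 2 := by
      have := sq_sum_le_card_mul_sum_sq (s := S.erase j) (f := f)
      rwa [hcard] at this
    have hQ : 0 = ∑ i ∈ S.erase j, f i → ∑ i ∈ S.erase j, f i ^ 2 = 0 := fun h =>
      Finset.sum_eq_zero fun i hi => by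
        rw [(Finset.sum_eq_zero_iff_of_nonneg hfT).1 h.symm i hi]
        norm_num
    set t := ∑ i ∈ S.erase j, f i
    set Q := ∑ i ∈ S.erase j, f i ^ 2
    set x := f j
    have hx0 : 0 ≤ x := hf j hj
    rcases ht0.eq_or_lt with ht | ht
    · have hQ0 : Q = 0 := hQ ht
      rw [← ht, hQ0] at IH
      rw [← ht, hQ0]
      simp only [zero_mul, zero_div, sub_zero, mul_zero, add_zero] at IH
      rcases hx0.eq_or_lt with hx | hx
      · rw [← hx]
        simpa using IH
      · have := two_block_le hn hx0 le_rfl (by linarith)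
        push_cast
        simp only [zero_mul, add_zero, ne_eq, OfNat.ofNat_ne_zero, not_false_eq_true, zero_pow,
          zero_div] at this ⊢
        linarith
    · have hs : 0 < x + t := by linarith
      have hB := two_block_le hn hx0 ht.le hs
      have hV : 0 ≤ Q - t ^ 2 / n := by
        rw [sub_nonneg, div_le_iff₀ hn0]
        linarith
      have hmass : (n + 1) * t ≤ n * (x + t) := by linarith
      have hc : entropyConst (n + 1) / (x + t) ≤ entropyConst n / t := by
        rw [div_le_div_iff₀ hs ht]
        have h1 := entropyConst_succ_mul_le hn
        have h2 := entropyConst_pos (n := n + 1) (by omega)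
        have h3 := mul_le_mul_of_nonneg_left hmass h2.le
        have h4 := mul_le_mul_of_nonneg_right h1 hs.le
        have h5 : (0 : ℝ) < n + 1 := by positivity
        refine le_of_mul_le_mul_left ?_ h5
        linarith
      have h := mul_le_mul_of_nonneg_right hc hV
      have e1 : entropyConst n / t * (Q - t ^ 2 / n) = entropyConst n * (Q / t - t / n) := by
        field_simp
      have e2 : entropyConst (n + 1) * ((x ^ 2 + Q) / (x + t) - (x + t) / (n + 1))
          = entropyConst (n + 1) * ((x ^ 2 + t ^ 2 / n) / (x + t) - (x + t) / (n + 1))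
            + entropyConst (n + 1) / (x + t) * (Q - t ^ 2 / n) := by
        field_simp
        ring
      push_cast
      rw [e2]
      linarith

/-! ### Power sums and the size of the threshold -/

lemma tangent_le_pow {x y : ℝ} (hx : 0 ≤ x) (hy : 0 ≤ y) (m : ℕ) :
    y ^ (m + 1) + (m + 1) * y ^ m * (x - y) ≤ x ^ (m + 1) := by
  induction m with
  | zero => simp
  | succ m ih =>
    have h1 := mul_le_mul_of_nonneg_left ih hx
    have h2 : 0 ≤ (m + 1) * y ^ m * (x - y) ^ 2 := by positivity
    push_cast
    rw [pow_succ x (m + 1), pow_succ y (m + 1), pow_succ y m] at *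
    linarith

/-- The quotient of the Taylor remainder `x ^ r - y ^ r - r y ^ (r - 1) (x - y)` by `(x - y) ^ 2` is
a polynomial with nonnegative coefficients, so on `[0, 1]` it is largest at `x = 1`. -/
lemma pow_le_tangent_add {x y : ℝ} (hx0 : 0 ≤ x) (hx1 : x ≤ 1) (hy0 : 0 ≤ y) (hy1 : y < 1) (m : ℕ) :
    x ^ (m + 1) ≤ y ^ (m + 1) + (m + 1) * y ^ m * (x - y)
      + (1 - y ^ (m + 1) - (m + 1) * y ^ m * (1 - y)) / (1 - y) ^ 2 * (x - y) ^ 2 := by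
  have hy : 1 - y ≠ 0 := by linarith
  induction m with
  | zero => simp
  | succ m ih =>
    have hlow := tangent_le_pow zero_le_one hy0 m
    rw [one_pow] at hlow
    set θ := (1 - y ^ (m + 1) - (m + 1) * y ^ m * (1 - y)) / (1 - y) ^ 2 with hθ
    have hθ0 : 0 ≤ θ := div_nonneg (by linarith) (by positivity)
    have e : (1 - y ^ (m + 1 + 1) - ((m + 1 : ℕ) + 1) * y ^ (m + 1) * (1 - y)) / (1 - y) ^ 2
        = θ + (m + 1) * y ^ m := by
      rw [hθ]
      push_cast
      field_simp
      ring
    rw [e]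
    have h1 := mul_le_mul_of_nonneg_left ih hx0
    have h2 : x * (θ * (x - y) ^ 2) ≤ θ * (x - y) ^ 2 :=
      mul_le_of_le_one_left (by positivity) hx1
    have e2 : x ^ (m + 1 + 1) = x * x ^ (m + 1) := by ring
    rw [e2]
    refine h1.trans ?_
    have e3 : x * (y ^ (m + 1) + (m + 1) * y ^ m * (x - y) + θ * (x - y) ^ 2)
        = y ^ (m + 1 + 1) + ((m + 1 : ℕ) + 1) * y ^ (m + 1) * (x - y)
          + (m + 1) * y ^ m * (x - y) ^ 2 + x * (θ * (x - y) ^ 2) := by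
      push_cast
      ring
    rw [e3]
    linarith

lemma pow_mul_log_mul_lt {t : ℝ} (ht : 1 ≤ t) (m : ℕ) :
    t ^ (m + 1) * log t * ((m + 2) * (m + 1)) < ((t + 1) ^ (m + 1) - 1) ^ 2 := by
  induction m with
  | zero =>
    have h := log_le_sub_one_of_pos (show 0 < t / 2 by linarith)
    rw [log_div (by linarith) (by norm_num)] at h
    have h2 := log_two_lt_d9
    norm_num
    nlinarith
  | succ m ih =>
    have hlog := log_nonneg ht
    have ht0 : 0 < t := by linarith
    have hA : 0 ≤ t ^ (m + 1) * log t := by positivity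
    have h1 : t ^ (m + 1 + 1) * log t * (((m + 1 : ℕ) + 2) * ((m + 1 : ℕ) + 1))
        ≤ (t + 1) ^ 2 * (t ^ (m + 1) * log t * ((m + 2) * (m + 1))) := by
      have hm : (0 : ℝ) ≤ m := Nat.cast_nonneg m
      have h3 : t * (m + 3) ≤ (t + 1) ^ 2 * (m + 1) := by
        nlinarith [mul_nonneg hm (show 0 ≤ t ^ 2 + t + 1 by positivity), sq_nonneg (t - 1)]
      have h4 := mul_le_mul_of_nonneg_left h3 (mul_nonneg hA (show (0 : ℝ) ≤ m + 2 by linarith))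
      push_cast
      calc _ = t ^ (m + 1) * log t * (m + 2) * (t * (m + 3)) := by ring
        _ ≤ _ := h4
        _ = _ := by ring
    have hP : 1 ≤ (t + 1) ^ (m + 1) := one_le_pow₀ (by linarith)
    have h2 : (t + 1) ^ 2 * ((t + 1) ^ (m + 1) - 1) ^ 2 ≤ ((t + 1) ^ (m + 1 + 1) - 1) ^ 2 := by
      rw [← mul_pow]
      refine pow_le_pow_left₀ (mul_nonneg (by linarith) (by linarith)) ?_ 2
      rw [pow_succ _ (m + 1)]
      linarith
    exact h1.trans_lt ((mul_lt_mul_of_pos_left ih (by positivity)).trans_le h2)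

lemma u_pred_lt_bound {r k : ℕ} (hr : 2 ≤ r) (hk : 2 ≤ k) :
    u r (k - 1) < ((k : ℝ) ^ (r - 1) - 1) ^ 2 / ((r : ℝ) * ((r : ℝ) - 1)) := by
  obtain ⟨m, rfl⟩ := Nat.exists_eq_add_of_le' hr
  obtain ⟨n, rfl⟩ := Nat.exists_eq_add_of_le' hk
  have h := pow_mul_log_mul_lt (t := (n : ℝ) + 1) (by linarith [n.cast_nonneg (α := ℝ)]) m
  rw [lt_div_iff₀ (by push_cast; nlinarith [m.cast_nonneg (α := ℝ)]), u]
  simp only [Nat.add_succ_sub_one]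
  push_cast
  rw [show (m : ℝ) + 2 - 1 = m + 1 by ring, show (n : ℝ) + 2 = n + 1 + 1 by ring]
  exact h

lemma u_pred_lt_u {r k : ℕ} (hk : 2 ≤ k) : u r (k - 1) < u r k := by
  obtain ⟨n, rfl⟩ := Nat.exists_eq_add_of_le' hk
  simp only [u, Nat.add_succ_sub_one]
  have hn : (0 : ℝ) ≤ n := n.cast_nonneg
  push_cast
  calc ((n : ℝ) + 1) ^ (r - 1) * log (n + 1) ≤ (n + 2) ^ (r - 1) * log (n + 1) :=
        mul_le_mul_of_nonneg_right (pow_le_pow_left₀ (by linarith) (by linarith) _)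
          (log_nonneg (by linarith))
    _ < _ := mul_lt_mul_of_pos_left (log_lt_log (by linarith) (by linarith)) (by positivity)

lemma u_nonneg (r n : ℕ) : 0 ≤ u r n := by
  rw [u]
  exact mul_nonneg (by positivity) (log_natCast_nonneg n)

/-- There is a quadratic majorant of the Taylor remainder of `x ^ r` at `1 / k` whose coefficient
`θ` is small enough for the threshold it yields to exceed `u r (k - 1)`. -/
lemma exists_quadratic_majorant {r k : ℕ} (hr : 2 ≤ r) (hk : 2 ≤ k) :
    ∃ θ : ℝ, 0 < θ ∧
      (∀ x : ℝ, 0 ≤ x → x ≤ 1 → x ^ r ≤ (1 / (k : ℝ)) ^ r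
        + r * (1 / (k : ℝ)) ^ (r - 1) * (x - 1 / k) + θ * (x - 1 / k) ^ 2) ∧
      u r (k - 1) * (1 / (k : ℝ) ^ (r - 1) * θ)
        < entropyConst k * (1 - 1 / (k : ℝ) ^ (r - 1)) ^ 2 := by
  have hk2 : (2 : ℝ) ≤ k := by exact_mod_cast hk
  have hk0 : (0 : ℝ) < k := by linarith
  have hy1 : 1 / (k : ℝ) < 1 := by rw [div_lt_one hk0]; linarith
  have hcast : ((k - 1 : ℕ) : ℝ) = k - 1 := by
    rw [Nat.cast_sub (by omega), Nat.cast_one]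
  obtain rfl | hr3 : r = 2 ∨ 3 ≤ r := by omega
  · -- the remainder of a square is exactly quadratic
    refine ⟨1, one_pos, fun x _ _ => le_of_eq (by norm_num; ring), ?_⟩
    obtain rfl | hk3 : k = 2 ∨ 3 ≤ k := by omega
    · norm_num [u, entropyConst]
    · have hk3' : (3 : ℝ) ≤ k := by exact_mod_cast hk3
      have hlog : 0 < log ((k : ℝ) - 1) := log_pos (by linarith)
      have hk2' : 0 < (k : ℝ) - 2 := by linarith
      rw [u, hcast, entropyConst, if_neg (by omega)]
      have e : ((k : ℝ) - 1) / (k - 2) * log (k - 1) * (1 - 1 / (k : ℝ) ^ (2 - 1)) ^ 2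
          - (k - 1) ^ (2 - 1) * log (k - 1) * (1 / (k : ℝ) ^ (2 - 1) * 1)
          = (k - 1) * log (k - 1) / (k ^ 2 * (k - 2)) := by
        norm_num
        field_simp
        ring
      have : 0 < ((k : ℝ) - 1) * log (k - 1) / (k ^ 2 * (k - 2)) :=
        div_pos (mul_pos (by linarith) hlog) (by positivity)
      linarith
  · obtain ⟨m, rfl⟩ := Nat.exists_eq_add_of_le' hr3
    have hy0 : 0 < 1 - 1 / (k : ℝ) := by linarith
    refine ⟨1 / (1 - 1 / (k : ℝ)) ^ 2, by positivity, fun x hx0 hx1 => ?_, ?_⟩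
    · have h := pow_le_tangent_add hx0 hx1 (by positivity) hy1 (m + 2)
      refine h.trans ?_
      simp only [Nat.add_succ_sub_one]
      push_cast
      have hle : (1 - (1 / (k : ℝ)) ^ (m + 2 + 1)
          - (m + 2 + 1) * (1 / (k : ℝ)) ^ (m + 2) * (1 - 1 / k)) / (1 - 1 / (k : ℝ)) ^ 2
          ≤ 1 / (1 - 1 / (k : ℝ)) ^ 2 := by
        refine div_le_div_of_nonneg_right ?_ (by positivity)
        have h1 : 0 ≤ (1 / (k : ℝ)) ^ (m + 2 + 1) := by positivity
        have h2 : 0 ≤ ((m : ℝ) + 2 + 1) * (1 / (k : ℝ)) ^ (m + 2) * (1 - 1 / k) := by positivity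
        linarith
      have := mul_le_mul_of_nonneg_right hle (sq_nonneg (x - 1 / (k : ℝ)))
      rw [show (m : ℝ) + 3 = m + 2 + 1 by ring]
      linarith
    · simp only [Nat.add_succ_sub_one]
      have hq1 : 1 / (k : ℝ) ^ (m + 2) < 1 := by
        rw [div_lt_one (by positivity)]
        exact one_lt_pow₀ (by linarith) (by omega)
      obtain rfl | hk3 : k = 2 ∨ 3 ≤ k := by omega
      -- at `k = 2` the logarithm in `u r (k - 1)` vanishes
      · have h0 : u (m + 3) (2 - 1) = 0 := by norm_num [u]
        rw [h0, zero_mul]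
        exact mul_pos (entropyConst_pos (by norm_num)) (by
          have : 0 < 1 - 1 / ((2 : ℕ) : ℝ) ^ (m + 2) := by linarith
          positivity)
      · have hk3' : (3 : ℝ) ≤ k := by exact_mod_cast hk3
        have hlog : 0 < log ((k : ℝ) - 1) := log_pos (by linarith)
        have hk2' : 0 < (k : ℝ) - 2 := by linarith
        have hk1' : (k : ℝ) - 1 ≠ 0 := by linarith
        rw [u, hcast, entropyConst, if_neg (by omega)]
        have h1 : (((k : ℝ) - 1) / k) ^ m ≤ 1 :=
          pow_le_one₀ (div_nonneg (by linarith) hk0.le) (by rw [div_le_one hk0]; linarith)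
        have e1 : ((k : ℝ) - 1) ^ (m + 3 - 1) * log (k - 1)
            * (1 / (k : ℝ) ^ (m + 2) * (1 / (1 - 1 / (k : ℝ)) ^ 2))
            = (((k : ℝ) - 1) / k) ^ m * log (k - 1) := by
          rw [div_pow, show m + 3 - 1 = m + 2 by omega]
          field_simp
          ring
        have hq : 1 / (k : ℝ) ^ (m + 2) ≤ 1 / (k : ℝ) ^ 2 :=
          one_div_le_one_div_of_le (by positivity) (pow_le_pow_right₀ (by linarith) (by omega))
        have hq2 : 1 / (k : ℝ) ^ 2 < 1 := by
          rw [div_lt_one (by positivity)]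
          nlinarith
        have h2 : (1 - 1 / (k : ℝ) ^ 2) ^ 2 ≤ (1 - 1 / (k : ℝ) ^ (m + 2)) ^ 2 :=
          pow_le_pow_left₀ (by linarith) (by linarith) 2
        have h3 : 1 < ((k : ℝ) - 1) / (k - 2) * (1 - 1 / (k : ℝ) ^ 2) ^ 2 := by
          have e : ((k : ℝ) - 1) / (k - 2) * (1 - 1 / (k : ℝ) ^ 2) ^ 2 - 1
              = (k ^ 3 * (k - 2) + 2 * k ^ 2 + (k - 1)) / ((k - 2) * k ^ 4) := by
            field_simp
            ring
          have : 0 < ((k : ℝ) ^ 3 * (k - 2) + 2 * k ^ 2 + (k - 1)) / ((k - 2) * k ^ 4) :=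
            div_pos (by
              have : 0 < (k : ℝ) - 1 := by linarith
              positivity) (by positivity)
          linarith
        have h4 : ((k : ℝ) - 1) / (k - 2) * (1 - 1 / (k : ℝ) ^ 2) ^ 2
            ≤ ((k : ℝ) - 1) / (k - 2) * (1 - 1 / (k : ℝ) ^ (m + 2)) ^ 2 :=
          mul_le_mul_of_nonneg_left h2 (div_nonneg (by linarith) hk2'.le)
        rw [e1]
        calc _ ≤ 1 * log ((k : ℝ) - 1) := mul_le_mul_of_nonneg_right h1 hlog.le
          _ < ((k : ℝ) - 1) / (k - 2) * (1 - 1 / (k : ℝ) ^ (m + 2)) ^ 2 * log (k - 1) :=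
            mul_lt_mul_of_pos_right (h3.trans_le h4) hlog
          _ = _ := by ring

/-! ### Comparison on doubly stochastic matrices -/

/-- `k` times the squared Frobenius distance from `X` to `J₀`. -/
noncomputable def deviation (k : ℕ) (X : Matrix (Fin k) (Fin k) ℝ) : ℝ :=
  k * ∑ i, ∑ j, (X i j - 1 / (k : ℝ) ^ 2) ^ 2

lemma deviation_pos {k : ℕ} (hk : 0 < k) {X : Matrix (Fin k) (Fin k) ℝ} (hX : X ≠ J₀ k) :
    0 < deviation k X := by
  refine mul_pos (by exact_mod_cast hk) ?_
  by_contra hcon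
  have hnn : ∀ i ∈ Finset.univ, 0 ≤ ∑ j, (X i j - 1 / (k : ℝ) ^ 2) ^ 2 :=
    fun i _ => Finset.sum_nonneg fun j _ => sq_nonneg _
  have h0 := (Finset.sum_eq_zero_iff_of_nonneg hnn).1
    (le_antisymm (not_lt.1 hcon) (Finset.sum_nonneg hnn))
  refine hX (Matrix.ext fun i j => ?_)
  have h1 := (Finset.sum_eq_zero_iff_of_nonneg fun j _ => sq_nonneg _).1
    (h0 i (Finset.mem_univ i)) j (Finset.mem_univ j)
  simpa [J₀, sub_eq_zero] using h1

lemma sum_sum_eq_one {k : ℕ} (hk : 0 < k) {X : Matrix (Fin k) (Fin k) ℝ} (hX : X ∈ W k) :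
    ∑ i, ∑ j, X i j = 1 := by
  have : (k : ℝ) ≠ 0 := by exact_mod_cast hk.ne'
  simp [hX.1, this]

lemma deviation_eq {k : ℕ} (hk : 0 < k) {X : Matrix (Fin k) (Fin k) ℝ} (hX : X ∈ W k) :
    deviation k X = k * ∑ i, ∑ j, X i j ^ 2 - 1 / k := by
  have hk0 : (k : ℝ) ≠ 0 := by exact_mod_cast hk.ne'
  have e : ∀ i j, (X i j - 1 / (k : ℝ) ^ 2) ^ 2
      = X i j ^ 2 - 2 / (k : ℝ) ^ 2 * X i j + 1 / (k : ℝ) ^ 4 := fun i j => by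
    field_simp
    ring
  simp only [deviation, e, Finset.sum_add_distrib, Finset.sum_sub_distrib, ← Finset.mul_sum,
    sum_sum_eq_one hk hX, Finset.sum_const, Finset.card_univ, Fintype.card_fin, nsmul_eq_mul]
  field_simp
  ring

/-- The row inequality `sum_mul_log_ge`, with mass `1 / k` in each row, summed over the rows. -/
lemma entropy_deficit_ge {k : ℕ} (hk : 1 ≤ k) {X : Matrix (Fin k) (Fin k) ℝ}
    (hK : X ∈ K k) (hW : X ∈ W k) :
    log (1 / (k : ℝ) ^ 2) + entropyConst k * deviation k X ≤ ∑ i, ∑ j, X i j * log (X i j) := by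
  have hk0 : (k : ℝ) ≠ 0 := by exact_mod_cast (by omega : k ≠ 0)
  have hrow : ∀ i, 1 / (k : ℝ) * log (1 / (k : ℝ) ^ 2)
      + entropyConst k * (k * ∑ j, X i j ^ 2 - 1 / (k : ℝ) ^ 2) ≤ ∑ j, X i j * log (X i j) := by
    intro i
    have h := sum_mul_log_ge hk Finset.univ (fun j => X i j) (by simp) fun j _ => (hK i j).1
    simp only [hW.1 i] at h
    have e1 : 1 / (k : ℝ) / k = 1 / (k : ℝ) ^ 2 := by field_simp
    have e2 : (∑ j, X i j ^ 2) / (1 / (k : ℝ)) = k * ∑ j, X i j ^ 2 := by field_simp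
    rwa [e1, e2] at h
  have h := Finset.sum_le_sum fun i (_ : i ∈ Finset.univ) => hrow i
  refine le_of_eq_of_le ?_ h
  rw [deviation_eq (by omega) hW]
  simp only [Finset.sum_add_distrib, Finset.sum_sub_distrib, ← Finset.mul_sum,
    Finset.sum_const, Finset.card_univ, Fintype.card_fin, nsmul_eq_mul]
  field_simp

/-- The linear part of the Taylor expansion at `1 / k` sums to zero over the entries of `k X`, so
the remainders add up to the excess of the power sum over its value at `J₀`. -/
lemma sum_pow_sub_eq {r k : ℕ} (hr : 1 ≤ r) (hk : 0 < k) {X : Matrix (Fin k) (Fin k) ℝ}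
    (hX : X ∈ W k) :
    ∑ i, ∑ j, ((k * X i j) ^ r - (1 / (k : ℝ)) ^ r
      - r * (1 / (k : ℝ)) ^ (r - 1) * (k * X i j - 1 / k))
      = (k : ℝ) ^ r * (∑ i, ∑ j, X i j ^ r - (1 / (k : ℝ) ^ (r - 1)) ^ 2) := by
  have hk0 : (k : ℝ) ≠ 0 := by exact_mod_cast hk.ne'
  obtain ⟨m, rfl⟩ := Nat.exists_eq_add_of_le' hr
  simp only [mul_pow, mul_sub, Finset.sum_sub_distrib, ← Finset.mul_sum, sum_sum_eq_one hk hX,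
    Finset.sum_const, Finset.card_univ, Fintype.card_fin, nsmul_eq_mul, Nat.add_sub_cancel,
    one_div_pow]
  field_simp
  ring

lemma sum_pow_ge {r k : ℕ} (hr : 1 ≤ r) (hk : 0 < k) {X : Matrix (Fin k) (Fin k) ℝ}
    (hK : X ∈ K k) (hW : X ∈ W k) :
    (1 / (k : ℝ) ^ (r - 1)) ^ 2 ≤ ∑ i, ∑ j, X i j ^ r := by
  have hk0 : (0 : ℝ) < k := by exact_mod_cast hk
  have h := sum_pow_sub_eq hr hk hW
  have h0 : 0 ≤ ∑ i, ∑ j, ((k * X i j) ^ r - (1 / (k : ℝ)) ^ r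
      - r * (1 / (k : ℝ)) ^ (r - 1) * (k * X i j - 1 / k)) := by
    refine Finset.sum_nonneg fun i _ => Finset.sum_nonneg fun j _ => ?_
    obtain ⟨m, rfl⟩ := Nat.exists_eq_add_of_le' hr
    have := tangent_le_pow (mul_nonneg hk0.le (hK i j).1) (show 0 ≤ 1 / (k : ℝ) by positivity) m
    push_cast
    linarith
  rw [h] at h0
  have := nonneg_of_mul_nonneg_right h0 (by positivity)
  linarith

lemma sum_pow_le {r k : ℕ} (hr : 1 ≤ r) (hk : 0 < k) {θ : ℝ}
    (hθ : ∀ x : ℝ, 0 ≤ x → x ≤ 1 → x ^ r ≤ (1 / (k : ℝ)) ^ r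
        + r * (1 / (k : ℝ)) ^ (r - 1) * (x - 1 / k) + θ * (x - 1 / k) ^ 2)
    {X : Matrix (Fin k) (Fin k) ℝ} (hK : X ∈ K k) (hW : X ∈ W k) :
    ∑ i, ∑ j, X i j ^ r
      ≤ (1 / (k : ℝ) ^ (r - 1)) ^ 2 + 1 / (k : ℝ) ^ (r - 1) * θ * deviation k X := by
  have hk0 : (0 : ℝ) < k := by exact_mod_cast hk
  have h := sum_pow_sub_eq hr hk hW
  have h0 : ∑ i, ∑ j, ((k * X i j) ^ r - (1 / (k : ℝ)) ^ r
      - r * (1 / (k : ℝ)) ^ (r - 1) * (k * X i j - 1 / k))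
      ≤ ∑ i, ∑ j, θ * (k : ℝ) ^ 2 * (X i j - 1 / (k : ℝ) ^ 2) ^ 2 := by
    refine Finset.sum_le_sum fun i _ => Finset.sum_le_sum fun j _ => ?_
    have := hθ (k * X i j) (mul_nonneg hk0.le (hK i j).1)
      (by have := (hK i j).2; rw [le_div_iff₀ hk0] at this; linarith)
    have e : θ * (k : ℝ) ^ 2 * (X i j - 1 / (k : ℝ) ^ 2) ^ 2
        = θ * (k * X i j - 1 / k) ^ 2 := by
      field_simp
    rw [e]
    linarith
  rw [h] at h0
  simp only [← Finset.mul_sum] at h0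
  have e : θ * (k : ℝ) ^ 2 * ∑ i, ∑ j, (X i j - 1 / (k : ℝ) ^ 2) ^ 2
      = (k : ℝ) ^ r * (1 / (k : ℝ) ^ (r - 1) * θ * deviation k X) := by
    obtain ⟨m, rfl⟩ := Nat.exists_eq_add_of_le' hr
    simp only [Nat.add_sub_cancel, deviation]
    generalize ∑ i, ∑ j, (X i j - 1 / (k : ℝ) ^ 2) ^ 2 = D
    field_simp
    ring
  rw [e] at h0
  have := le_of_mul_le_mul_left h0 (by positivity)
  linarith

lemma F_J₀ {r k : ℕ} (hr : 1 ≤ r) (hk : 0 < k) (c : ℝ) :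
    F r k c (J₀ k) = -log (1 / (k : ℝ) ^ 2) + c * log ((1 - 1 / (k : ℝ) ^ (r - 1)) ^ 2) := by
  have hk0 : (k : ℝ) ≠ 0 := by exact_mod_cast hk.ne'
  obtain ⟨m, rfl⟩ := Nat.exists_eq_add_of_le' hr
  simp only [F, J₀, Matrix.of_apply, Finset.sum_const, Finset.card_univ, Fintype.card_fin,
    nsmul_eq_mul, Nat.add_sub_cancel, one_div_pow]
  congr 1
  · field_simp
  · congr 2
    field_simp
    ring

lemma J₀_mem_interior {k : ℕ} (hk : 2 ≤ k) : J₀ k ∈ interior (K k) := by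
  have hk2 : (2 : ℝ) ≤ k := by exact_mod_cast hk
  have hk0 : (0 : ℝ) < k := by linarith
  refine mem_interior.2 ⟨{X | ∀ i j, 0 < X i j ∧ X i j < 1 / (k : ℝ)},
    fun X hX i j => ⟨(hX i j).1.le, (hX i j).2.le⟩, ?_, fun i j => ?_⟩
  · simp only [Set.ofPred_forall]
    refine isOpen_iInter_of_finite fun i => isOpen_iInter_of_finite fun j => ?_
    exact (isOpen_lt continuous_const (continuous_id.matrix_elem i j)).inter
      (isOpen_lt (continuous_id.matrix_elem i j) continuous_const)
  · simp only [J₀, Matrix.of_apply]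
    refine ⟨by positivity, one_div_lt_one_div_of_lt hk0 (by nlinarith)⟩

lemma J₀_mem_W {k : ℕ} (hk : 0 < k) : J₀ k ∈ W k := by
  have hk0 : (k : ℝ) ≠ 0 := by exact_mod_cast hk.ne'
  constructor <;> intro i <;>
  · simp only [J₀, Matrix.of_apply, Finset.sum_const, Finset.card_univ, Fintype.card_fin,
      nsmul_eq_mul]
    field_simp

/-- Below the threshold the entropy deficit outweighs the gain in the logarithmic term, which
concavity of `log` bounds by its linearisation at `J₀`. -/
lemma F_lt_F_J₀ {r k : ℕ} (hr : 2 ≤ r) (hk : 2 ≤ k) {θ : ℝ}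
    (hθ : ∀ x : ℝ, 0 ≤ x → x ≤ 1 → x ^ r ≤ (1 / (k : ℝ)) ^ r
        + r * (1 / (k : ℝ)) ^ (r - 1) * (x - 1 / k) + θ * (x - 1 / k) ^ 2)
    {c : ℝ} (hc : c * (1 / (k : ℝ) ^ (r - 1) * θ)
      < entropyConst k * (1 - 1 / (k : ℝ) ^ (r - 1)) ^ 2)
    {X : Matrix (Fin k) (Fin k) ℝ} (hK : X ∈ K k) (hW : X ∈ W k) (hX : X ≠ J₀ k) :
    F r k c X < F r k c (J₀ k) := by
  have hk2 : (2 : ℝ) ≤ k := by exact_mod_cast hk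
  rw [F_J₀ (by omega) (by omega), F]
  have hent := entropy_deficit_ge (by omega) hK hW
  have hlow := sum_pow_ge (r := r) (by omega) (by omega) hK hW
  have hupp := sum_pow_le (by omega) (by omega) hθ hK hW
  have hV := deviation_pos (by omega) hX
  have ha := entropyConst_pos (n := k) (by omega)
  have hq1 : 1 / (k : ℝ) ^ (r - 1) < 1 := by
    rw [div_lt_one (by positivity)]
    exact one_lt_pow₀ (by linarith) (by omega)
  have e : 1 - 2 / (k : ℝ) ^ (r - 1) = 1 - 2 * (1 / (k : ℝ) ^ (r - 1)) := by ring
  rw [e]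
  set q := 1 / (k : ℝ) ^ (r - 1)
  set V := deviation k X
  set S := ∑ i, ∑ j, X i j ^ r
  have hB : 0 < (1 - q) ^ 2 := pow_pos (by linarith) 2
  have hA : (1 - q) ^ 2 ≤ 1 - 2 * q + S := by linarith
  have hL0 : log ((1 - q) ^ 2) ≤ log (1 - 2 * q + S) := log_le_log hB hA
  have hL : log (1 - 2 * q + S) - log ((1 - q) ^ 2) ≤ q * θ * V / (1 - q) ^ 2 := by
    rw [← log_div (by linarith) hB.ne']
    refine (log_le_sub_one_of_pos (div_pos (by linarith) hB)).trans ?_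
    rw [div_sub_one hB.ne']
    exact div_le_div_of_nonneg_right (by linarith) hB.le
  have key : c * (log (1 - 2 * q + S) - log ((1 - q) ^ 2)) < entropyConst k * V := by
    rcases le_total c 0 with h | h
    · exact (mul_nonpos_of_nonpos_of_nonneg h (by linarith)).trans_lt (mul_pos ha hV)
    · refine (mul_le_mul_of_nonneg_left hL h).trans_lt ?_
      rw [← mul_div_assoc, div_lt_iff₀ hB]
      have := mul_lt_mul_of_pos_right hc hV
      linarith
  linarith

end HypergraphMoment

theorem lemma2p2 (r k : ℕ) (hr : 2 ≤ r) (hk : 2 ≤ k) :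
    ∃ crk : ℝ, 0 < crk ∧
      HypergraphMoment.u r (k - 1) < crk ∧ crk < HypergraphMoment.u r k ∧
      crk ≤ ((k : ℝ) ^ (r - 1) - 1) ^ 2 / ((r : ℝ) * ((r : ℝ) - 1)) ∧
      HypergraphMoment.J₀ k ∈ interior (HypergraphMoment.K k) ∩ HypergraphMoment.W k ∧
      ∀ c : ℝ, c < crk →
        ∀ X ∈ HypergraphMoment.K k ∩ HypergraphMoment.W k, X ≠ HypergraphMoment.J₀ k →
          HypergraphMoment.F r k c X < HypergraphMoment.F r k c (HypergraphMoment.J₀ k) := by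
  open HypergraphMoment in
  obtain ⟨θ, hθ0, hθ, hlt⟩ := exists_quadratic_majorant hr hk
  have hk0 : (0 : ℝ) < k := by exact_mod_cast (by omega : 0 < k)
  have hqθ : 0 < 1 / (k : ℝ) ^ (r - 1) * θ := by positivity
  rw [← lt_div_iff₀ hqθ] at hlt
  obtain ⟨crk, h1, h2⟩ := exists_between
    (lt_min hlt (lt_min (u_pred_lt_bound hr hk) (u_pred_lt_u (r := r) hk)))
  rw [lt_min_iff, lt_min_iff] at h2
  refine ⟨crk, (u_nonneg r (k - 1)).trans_lt h1, h1, h2.2.2, h2.2.1.le,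
    ⟨J₀_mem_interior hk, J₀_mem_W (by omega)⟩, fun c hc X hX hne => ?_⟩
  exact F_lt_F_J₀ hr hk hθ ((lt_div_iff₀ hqθ).1 (hc.trans h2.1)) hX.1 hX.2 hne
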